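/- Let $k$ be a field of characteristic $p>0$. For $n\ge 1$ let $\Lambda_\infty([n],[m])$ be the set of non-decreasing maps $f:\mathbb Z\to\mathbb Z$ with $f(a+n)=f(a)+m$, let $\sigma(a)=a+m$ on $[m]$, and let $\Lambda_p$ be the category with objects $[n]$, $n\ge1$, and morphisms $\Lambda_p([n],[m])=\Lambda_\infty([n],[m])/\sigma^p$. Let $E$ be a $p$-cyclic object, i.e. a functor from $\Lambda_p$ to $k$-vector spaces. On $E([n])$ let $\tau$ be $(-1)^{n-1}$ times the action of $a\mapsto a+1$, and $\sigma$ the action of $a\mapsto a+n$, so that $\tau^n=\sigma$ and $\sigma^p=\mathrm{id}$. For $0\le i\le n$ let $m_i:E([n+1])\to E([n])$ be the action of the map which sends $a(n+1)+j$ $(0\le j\le n)$ to $an+j$ if $j\le i$ and to $an+j-1$ if $j>i$; put $b=\sum_{i=0}^{n}(-1)^im_i$ and $b'=\sum_{i=0}^{n-1}(-1)^im_i$. The cyclic homology $HC_\bullet(E)$ is the homology of the total complex of the bicomplex with entry $E([n])$ in every column $a\ge0$ and row $n\ge1$ (in degree $a+n-1$), with horizontal differentials $\mathrm{id}-\tau$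 (from odd to even columns) and $\mathrm{id}+\tau+\dots+\tau^{pn-1}$ (from even to odd columns) and vertical differentials $b$ in even columns and $-b'$ in odd columns. It is also computed by the complex obtained by replacing the $n$-th row of this bicomplex with the Hochschild-Serre diagram for $\mathbb Z/p\subset\mathbb Z/pn$: entries $E([n])$ at $(c,r)$, $c,r\ge0$, in degree $c+r+n-1$; differentials $(c+1,r)\to(c,r)$ equal to $\mathrm{id}-\sigma$ for $c$ even and $\mathrm{id}+\sigma+\dots+\sigma^{p-1}$ for $c$ odd; differentials $(c,r+1)\to(c,r)$ equal to $(-1)^c$ times $\mathrm{id}-\tau$ for $r$ even and $\mathrm{id}+\tau+\dots+\tau^{n-1}$ for $r$ odd; correcting terms $-\mathrm{id}:(c,r+2)\to(c+1,r)$ for $c$ even; and differentials from $E([n+1])$ to $E([n])$ at each fixed $(c,r)$ equal to $(-1)^{c+r}$ times $b$ for $r$ even and $b'$ for $r$ odd. The comparison isomorphism is induced by the chain homotopy equivalence which sends $x\in E([n])$ in column $a$ of the bicomplex to the element with components $(\mathrm{id}+\sigma+\dots+\sigma^{p-1})^{\lfloor r/2\rfloor}x$ at the places $(c,r)$ with $c+r=a$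 and $c$ even. Let $u':HC_\bullet(E)\to HC_{\bullet-2}(E)$ be the vertical periodicity map, induced by the shift of the Hochschild-Serre version of the complex by two rows, $(c,r+2)\to(c,r)$ (rows $r=0,1$ go to $0$). Then $u'=0$ in every degree. -/

import Mathlib

open CategoryTheory

namespace PCyclic

/-- The maps `[n] ⟶ [m]` of the category `Λ_∞`: monotone maps `f : ℤ → ℤ` with
`f (a + n) = f a + m` for all `a`. -/
abbrev InfHom (n m : ℕ+) : Type :=
  {f : ℤ → ℤ // Monotone f ∧ ∀ a, f (a + n) = f a + m}

namespace InfHom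

/-- The identity of `[n]`. -/
def id (n : ℕ+) : InfHom n n := ⟨fun a => a, fun _ _ h => h, fun _ => rfl⟩

/-- Composition in `Λ_∞`, in diagrammatic order: `f` first, then `g`. -/
def comp {n m l : ℕ+} (f : InfHom n m) (g : InfHom m l) : InfHom n l :=
  ⟨fun a => g.1 (f.1 a), fun _ _ h => g.2.1 (f.2.1 h),
    fun a => by
      change g.1 (f.1 (a + n)) = g.1 (f.1 a) + l
      rw [f.2.2, g.2.2]⟩

theorem apply_add_mul {n m : ℕ+} (f : InfHom n m) (a j : ℤ) :
    f.1 (a + j * n) = f.1 a + j * m := by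
  induction j using Int.induction_on with
  | zero => simp
  | succ i ih =>
    have h := f.2.2 (a + i * n)
    have e : a + i * n + n = a + (i + 1) * (n : ℤ) := by ring
    rw [e] at h
    rw [h, ih]; ring
  | pred i ih =>
    have h := f.2.2 (a + (-i - 1) * n)
    have e : a + (-(i : ℤ) - 1) * n + n = a + (-i) * (n : ℤ) := by ring
    rw [e, ih] at h
    linarith

/-- Two maps `[n] ⟶ [m]` of `Λ_∞` are identified in `Λ_p` if they differ by a power of `σ ^ p`,
where `σ : [m] ⟶ [m]` is the map `a ↦ a + m`. -/
def setoid (p : ℕ) (n m : ℕ+) : Setoid (InfHom n m) where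
  r f g := ∃ j : ℤ, ∀ a, g.1 a = f.1 a + j * p * m
  iseqv :=
    { refl := fun f => ⟨0, fun a => by simp⟩
      symm := fun ⟨j, h⟩ => ⟨-j, fun a => by rw [h]; ring⟩
      trans := fun ⟨i, h⟩ ⟨j, h'⟩ => ⟨i + j, fun a => by rw [h', h]; ring⟩ }

end InfHom

/-- The category `Λ_p`: its objects `[n]` are numbered by the integers `n ≥ 1`. -/
structure Lam (p : ℕ) where
  /-- The number `n` of the object `[n]`. -/
  size : ℕ+

/-- The maps of `Λ_p` are the maps of `Λ_∞` modulo `σ ^ p`. -/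
instance (p : ℕ) : Category.{0} (Lam p) where
  Hom X Y := Quotient (InfHom.setoid p X.size Y.size)
  id X := Quotient.mk _ (InfHom.id X.size)
  comp {X Y Z} f g := Quotient.map₂ (sa := InfHom.setoid p X.size Y.size)
    (sb := InfHom.setoid p Y.size Z.size) (sc := InfHom.setoid p X.size Z.size) InfHom.comp
    (by
      rintro f f' ⟨i, hi⟩ g g' ⟨j, hj⟩
      refine ⟨i + j, fun a => ?_⟩
      change g'.1 (f'.1 a) = g.1 (f.1 a) + _
      rw [hj, hi, InfHom.apply_add_mul]
      ring) f g
  id_comp f := by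
    induction f using Quotient.inductionOn; rfl
  comp_id f := by
    induction f using Quotient.inductionOn; rfl
  assoc f g h := by
    induction f using Quotient.inductionOn
    induction g using Quotient.inductionOn
    induction h using Quotient.inductionOn
    rfl

/-- The map of `Λ_p` represented by a map of `Λ_∞`. -/
def Lam.homMk {p : ℕ} {X Y : Lam p} (f : InfHom X.size Y.size) : X ⟶ Y :=
  Quotient.mk (InfHom.setoid p X.size Y.size) f

/-- The object `[n + 1]` of `Λ_p`. -/
abbrev Lam.ob (p n : ℕ) : Lam p := ⟨n.succPNat⟩

/-- The map `τ : [n] ⟶ [n]`, `a ↦ a + 1`. -/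
def InfHom.rot (n : ℕ+) : InfHom n n :=
  ⟨fun a => a + 1, fun _ _ h => by simpa using h, fun a => by ring⟩

/-- The map `σ : [n] ⟶ [n]`, `a ↦ a + n`. -/
def InfHom.sig (n : ℕ+) : InfHom n n :=
  ⟨fun a => a + n, fun _ _ h => by simpa using h, fun a => by ring⟩

/-- The function underlying the face map `[n + 2] ⟶ [n + 1]` with number `i`, in closed form.
For `0 ≤ i ≤ n + 1` and `0 ≤ b ≤ n + 1` it sends `a * (n + 2) + b` to `a * (n + 1) + b` if `b ≤ i`
and to `a * (n + 1) + b - 1` if `b > i`; see `faceFun_apply`. -/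
def faceFun (n i : ℕ) (x : ℤ) : ℤ := x - (x + (n + 1 - i)) / (n + 2)

theorem succPNat_cast (n : ℕ) : ((n.succPNat : ℕ+) : ℤ) = n + 1 := by
  simp

theorem faceFun_period (n i : ℕ) (x a : ℤ) :
    faceFun n i (a * (n + 2) + x) = a * (n + 1) + faceFun n i x := by
  unfold faceFun
  have e : a * ((n : ℤ) + 2) + x + (n + 1 - i) = x + (n + 1 - i) + a * (n + 2) := by ring
  rw [e, Int.add_mul_ediv_right _ _ (by omega)]
  ring

theorem faceFun_small {n i : ℕ} (hi : i ≤ n + 1) {b : ℤ} (h0 : 0 ≤ b) (hb : b ≤ n + 1) :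
    faceFun n i b = if b ≤ i then b else b - 1 := by
  unfold faceFun
  split_ifs with h
  · rw [Int.ediv_eq_zero_of_lt (by omega) (by omega)]; ring
  · have e : b + ((n : ℤ) + 1 - i) = (b - i - 1) + 1 * (n + 2) := by ring
    rw [e, Int.add_mul_ediv_right _ _ (by omega), Int.ediv_eq_zero_of_lt (by omega) (by omega)]
    ring

/-- The usual description of the face maps. -/
theorem faceFun_apply {n i : ℕ} (hi : i ≤ n + 1) (a : ℤ) {b : ℤ} (h0 : 0 ≤ b) (hb : b ≤ n + 1) :
    faceFun n i (a * (n + 2) + b)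
      = if b ≤ i then a * (n + 1) + b else a * (n + 1) + b - 1 := by
  rw [faceFun_period, faceFun_small hi h0 hb]
  split_ifs <;> ring

theorem faceFun_top {n i : ℕ} (hi : i ≤ n + 1) :
    faceFun n i (n + 2) = n + 1 := by
  have h := faceFun_period n i 0 1
  rw [faceFun_small hi le_rfl (by omega)] at h
  simpa using h

theorem faceFun_mono (n i : ℕ) : Monotone (faceFun n i) := by
  refine monotone_int_of_le_succ fun x => ?_
  unfold faceFun
  have h : (x + 1 + ((n : ℤ) + 1 - i)) / (n + 2)
      ≤ (x + (n + 1 - i) + 1 * (n + 2)) / (n + 2) :=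
    Int.ediv_le_ediv (by omega) (by omega)
  rw [Int.add_mul_ediv_right _ _ (by omega)] at h
  omega

/-- The face map `[n + 2] ⟶ [n + 1]` with number `i`, used for `0 ≤ i ≤ n + 1`. -/
def InfHom.face (n i : ℕ) : InfHom (n + 1).succPNat n.succPNat :=
  ⟨faceFun n i, faceFun_mono n i, fun a => by
    have h := faceFun_period n i a 1
    have e : a + (((n + 1).succPNat : ℕ+) : ℤ) = 1 * (n + 2) + a := by
      rw [succPNat_cast]; push_cast; ring
    rw [e, h, succPNat_cast]; ring⟩

theorem InfHom.ext_of_small {n m : ℕ+} {f g : InfHom n m}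
    (h : ∀ b : ℤ, 0 ≤ b → b < n → f.1 b = g.1 b) : f = g := by
  apply Subtype.ext
  funext a
  have hn : (0 : ℤ) < n := by exact_mod_cast n.pos
  have e : a = a % n + (a / n) * n := by
    rw [mul_comm]; exact (Int.emod_add_mul_ediv a n).symm
  rw [e, f.apply_add_mul, g.apply_add_mul,
    h _ (Int.emod_nonneg _ hn.ne') (Int.emod_lt_of_pos _ hn)]

theorem InfHom.face_comp_face {n i j : ℕ} (hij : i < j) (hj : j ≤ n + 2) :
    (InfHom.face (n + 1) j).comp (InfHom.face n i)
      = (InfHom.face (n + 1) i).comp (InfHom.face n (j - 1)) := by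
  apply InfHom.ext_of_small
  intro b h0 hb
  have hb' : b ≤ n + 2 := by
    have h := succPNat_cast (n + 1 + 1)
    push_cast at h
    omega
  change faceFun n i (faceFun (n + 1) j b) = faceFun n (j - 1) (faceFun (n + 1) i b)
  rw [faceFun_small (n := n + 1) (i := j) (by omega) h0 (by push_cast; omega),
    faceFun_small (n := n + 1) (i := i) (by omega) h0 (by push_cast; omega)]
  have key : ∀ (l : ℕ), l ≤ n + 1 → ∀ c : ℤ, 0 ≤ c → c ≤ n + 2 →
      faceFun n l c = if c ≤ l then c else c - 1 := by
    intro l hl c hc hc'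
    by_cases hc2 : c = n + 2
    · subst hc2
      rw [faceFun_top hl, if_neg (by omega)]; ring
    · exact faceFun_small hl hc (by omega)
  split_ifs with h1 h2 h2
  · rw [key _ (by omega) _ h0 (by omega), key _ (by omega) _ h0 (by omega)]
    split_ifs <;> omega
  · rw [key _ (by omega) _ h0 (by omega),
      key _ (by omega) _ (by omega) (by omega)]
    split_ifs <;> omega
  · omega
  · rw [key _ (by omega) _ (by omega) (by omega),
      key _ (by omega) _ (by omega) (by omega)]
    split_ifs <;> omega

theorem InfHom.rot_comp_face_succ {n i : ℕ} (hi : i ≤ n) :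
    (InfHom.rot _).comp (InfHom.face n (i + 1)) = (InfHom.face n i).comp (InfHom.rot _) := by
  apply InfHom.ext_of_small
  intro b h0 hb
  have hb' : b ≤ n + 1 := by rw [succPNat_cast] at hb; push_cast at hb; omega
  change faceFun n (i + 1) (b + 1) = faceFun n i b + 1
  rw [faceFun_small (i := i) (by omega) h0 hb']
  by_cases hc : b = n + 1
  · subst hc
    rw [if_neg (by omega)]
    by_cases hin : i = n
    · subst hin
      have h := faceFun_period i (i + 1) 0 1
      rw [faceFun_small (by omega) le_rfl (by omega)] at h
      have e : (i : ℤ) + 1 + 1 = 1 * (i + 2) + 0 := by ring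
      rw [e, h, if_pos (by omega)]; ring
    · have e : (n : ℤ) + 1 + 1 = n + 2 := by ring
      rw [e, faceFun_top (by omega)]; ring
  · rw [faceFun_small (by omega) (by omega) (by omega)]
    split_ifs <;> push_cast at * <;> omega

theorem InfHom.rot_comp_face_zero (n : ℕ) :
    (InfHom.rot _).comp (InfHom.face n 0) = InfHom.face n (n + 1) := by
  apply InfHom.ext_of_small
  intro b h0 hb
  have hb' : b ≤ n + 1 := by rw [succPNat_cast] at hb; push_cast at hb; omega
  change faceFun n 0 (b + 1) = faceFun n (n + 1) b
  rw [faceFun_small (i := n + 1) (by omega) h0 hb', if_pos (by push_cast; omega)]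
  by_cases hc : b = n + 1
  · subst hc
    have e : (n : ℤ) + 1 + 1 = n + 2 := by ring
    rw [e, faceFun_top (by omega)]
  · rw [faceFun_small (by omega) (by omega) (by omega), if_neg (by push_cast; omega)]; ring

theorem InfHom.comp_sig {n m : ℕ+} (f : InfHom n m) :
    f.comp (InfHom.sig m) = (InfHom.sig n).comp f :=
  Subtype.ext (funext fun a => (f.2.2 a).symm)

universe u v

section Operators

variable {k : Type u} [Field k] {p : ℕ} (E : Lam p ⥤ ModuleCat.{v} k)

/-- The vector space `E([n + 1])`. -/
abbrev V (n : ℕ) : Type v := E.obj (Lam.ob p n)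

/-- The linear map `E([n + 1]) → E([m + 1])` given by a map of `Λ_∞`. -/
def act {n m : ℕ} (f : InfHom n.succPNat m.succPNat) : V E n →ₗ[k] V E m :=
  (E.map (Lam.homMk (X := Lam.ob p n) (Y := Lam.ob p m) f)).hom

/-- The map `τ` on `E([n + 1])`, twisted by the sign `(-1) ^ n`. -/
def tau (n : ℕ) : Module.End k (V E n) := (-1 : k) ^ n • act E (InfHom.rot n.succPNat)

/-- The map `σ` on `E([n + 1])`, with `σ ^ p = id`; it equals `τ ^ (n + 1)`. -/
def sigma (n : ℕ) : Module.End k (V E n) := act E (InfHom.sig n.succPNat)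

/-- The map `m_i : E([n + 2]) → E([n + 1])`. -/
def face (n i : ℕ) : V E (n + 1) →ₗ[k] V E n := act E (InfHom.face n i)

/-- The differential `b = ∑_{0 ≤ i ≤ n + 1} (-1) ^ i m_i` from `E([n + 2])` to `E([n + 1])`. -/
def b (n : ℕ) : V E (n + 1) →ₗ[k] V E n :=
  ∑ i ∈ Finset.range (n + 2), (-1 : k) ^ i • face E n i

/-- The differential `b' = ∑_{0 ≤ i ≤ n} (-1) ^ i m_i` from `E([n + 2])` to `E([n + 1])`. -/
def b' (n : ℕ) : V E (n + 1) →ₗ[k] V E n :=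
  ∑ i ∈ Finset.range (n + 1), (-1 : k) ^ i • face E n i

/-- The sum `id + τ + ⋯ + τ ^ n` on `E([n + 1])`. -/
def normTau (n : ℕ) : Module.End k (V E n) := ∑ j ∈ Finset.range (n + 1), tau E n ^ j

/-- The sum `id + σ + ⋯ + σ ^ (p - 1)` on `E([n + 1])`. -/
def normSigma (n : ℕ) : Module.End k (V E n) := ∑ j ∈ Finset.range p, sigma E n ^ j

/-- The sum `id + τ + ⋯ + τ ^ (p (n + 1) - 1)` on `E([n + 1])`. -/
def normFull (n : ℕ) : Module.End k (V E n) :=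
  ∑ j ∈ Finset.range (p * (n + 1)), tau E n ^ j

theorem act_comp {n m l : ℕ} (f : InfHom n.succPNat m.succPNat)
    (g : InfHom m.succPNat l.succPNat) : act E (f.comp g) = act E g ∘ₗ act E f := by
  have h : (Lam.homMk (X := Lam.ob p n) (Y := Lam.ob p l) (f.comp g))
      = Lam.homMk (X := Lam.ob p n) (Y := Lam.ob p m) f
        ≫ Lam.homMk (X := Lam.ob p m) (Y := Lam.ob p l) g := rfl
  unfold act
  rw [h, E.map_comp]
  rfl

theorem act_rot_pow (n j : ℕ) :
    ∃ f : InfHom n.succPNat n.succPNat, (∀ a, f.1 a = a + j) ∧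
      act E (InfHom.rot n.succPNat) ^ j = act E f := by
  induction j with
  | zero =>
    refine ⟨InfHom.id _, fun a => by simp [InfHom.id], ?_⟩
    rw [pow_zero]
    have h : (Lam.homMk (X := Lam.ob p n) (Y := Lam.ob p n) (InfHom.id n.succPNat)) = 𝟙 _ := rfl
    unfold act
    rw [h, E.map_id]
    rfl
  | succ j ih =>
    obtain ⟨f, hf, h⟩ := ih
    refine ⟨f.comp (InfHom.rot _), fun a => ?_, ?_⟩
    · change f.1 a + 1 = _
      rw [hf]; push_cast; ring
    · rw [act_comp, pow_succ', h]; rfl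

theorem tau_pow (n : ℕ) : tau E n ^ (n + 1) = sigma E n := by
  obtain ⟨f, hf, h⟩ := act_rot_pow E n (n + 1)
  have e : f = InfHom.sig n.succPNat := Subtype.ext (funext fun a => by
    rw [hf]; change _ = a + ((n.succPNat : ℕ+) : ℤ); rw [succPNat_cast]; push_cast; ring)
  rw [tau, smul_pow, h, e, ← pow_mul, Even.neg_one_pow (Nat.even_mul_succ_self n), one_smul]
  rfl

theorem sigma_pow (n : ℕ) : sigma E n ^ p = 1 := by
  rw [← tau_pow, ← pow_mul, tau, smul_pow, ← pow_mul, ← mul_assoc,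
    Even.neg_one_pow ((Nat.even_mul_succ_self n).mul_right p), one_smul]
  obtain ⟨f, hf, h⟩ := act_rot_pow E n ((n + 1) * p)
  rw [h]
  have e : Lam.homMk (X := Lam.ob p n) (Y := Lam.ob p n) f = 𝟙 _ := by
    refine Quotient.sound ⟨-1, fun a => ?_⟩
    change a = f.1 a + -1 * p * ((n.succPNat : ℕ+) : ℤ)
    rw [hf, succPNat_cast]; push_cast; ring
  unfold act
  rw [e, E.map_id]
  rfl

theorem sigma_face (n i : ℕ) (x : V E (n + 1)) :
    sigma E n (face E n i x) = face E n i (sigma E (n + 1) x) := by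
  have h := act_comp E (InfHom.face n i) (InfHom.sig n.succPNat)
  rw [InfHom.comp_sig, act_comp] at h
  exact (LinearMap.congr_fun h x).symm

theorem face_face {n i j : ℕ} (hij : i < j) (hj : j ≤ n + 2) (x : V E (n + 2)) :
    face E n i (face E (n + 1) j x) = face E n (j - 1) (face E (n + 1) i x) := by
  have h := act_comp E (InfHom.face (n + 1) j) (InfHom.face n i)
  rw [InfHom.face_comp_face hij hj, act_comp] at h
  exact (LinearMap.congr_fun h x).symm

theorem face_tau_succ {n i : ℕ} (hi : i ≤ n) (x : V E (n + 1)) :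
    face E n (i + 1) (tau E (n + 1) x) = -tau E n (face E n i x) := by
  have h := act_comp E (InfHom.rot _) (InfHom.face n (i + 1))
  rw [InfHom.rot_comp_face_succ hi, act_comp] at h
  have h' := LinearMap.congr_fun h x
  simp only [LinearMap.comp_apply] at h'
  simp only [tau, face, LinearMap.smul_apply, map_smul, h', pow_succ]
  simp

theorem face_tau_zero (n : ℕ) (x : V E (n + 1)) :
    face E n 0 (tau E (n + 1) x) = (-1 : k) ^ (n + 1) • face E n (n + 1) x := by
  have h := act_comp E (InfHom.rot _) (InfHom.face n 0)
  rw [InfHom.rot_comp_face_zero] at h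
  have h' := LinearMap.congr_fun h x
  simp only [LinearMap.comp_apply] at h'
  simp only [tau, face, LinearMap.smul_apply, map_smul, h']

theorem alt_sum_zero {A : Type*} [AddCommGroup A] [Module k A] (m : ℕ) (F : ℕ → ℕ → A)
    (h : ∀ i j, i < j → j ≤ m → F i j = F (j - 1) i) :
    ∑ i ∈ Finset.range m, ∑ j ∈ Finset.range (m + 1), (-1 : k) ^ (i + j) • F i j = 0 := by
  rw [← Finset.sum_product']
  refine Finset.sum_involution
    (fun t _ => if t.1 < t.2 then (t.2 - 1, t.1) else (t.2, t.1 + 1)) ?_ ?_ ?_ ?_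
  · rintro ⟨i, j⟩ ht
    simp only [Finset.mem_product, Finset.mem_range] at ht
    by_cases hij : i < j
    · obtain ⟨j, rfl⟩ : ∃ l, j = l + 1 := ⟨j - 1, by omega⟩
      simp only [hij, if_true]
      rw [h i (j + 1) hij (by omega), ← add_smul]
      simp only [Nat.add_sub_cancel, add_comm j i, ← add_assoc, pow_succ]
      simp
    · simp only [hij, if_false]
      rw [h j (i + 1) (by omega) (by omega), Nat.add_sub_cancel, ← add_smul]
      simp only [add_comm j, add_right_comm i 1 j, pow_succ]
      simp
  · rintro ⟨i, j⟩ ht _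
    by_cases hij : i < j
    · simp only [hij, if_true, ne_eq, Prod.mk.injEq]; omega
    · simp only [hij, if_false, ne_eq, Prod.mk.injEq]; omega
  · rintro ⟨i, j⟩ ht
    simp only [Finset.mem_product, Finset.mem_range] at ht ⊢
    by_cases hij : i < j
    · simp only [hij, if_true]; omega
    · simp only [hij, if_false]; omega
  · rintro ⟨i, j⟩ ht
    by_cases hij : i < j
    · obtain ⟨j, rfl⟩ : ∃ l, j = l + 1 := ⟨j - 1, by omega⟩
      have : ¬ (j < i) := by omega
      simp only [hij, if_true, Nat.add_sub_cancel, this, if_false]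
    · have : j < i + 1 := by omega
      simp only [hij, if_false, this, if_true, Nat.add_sub_cancel]

theorem b_b (n : ℕ) (x : V E (n + 2)) : b E n (b E (n + 1) x) = 0 := by
  have h := alt_sum_zero (k := k) (n + 2) (fun i j => face E n i (face E (n + 1) j x))
    (fun i j hij hj => face_face E hij hj x)
  simp only [b, LinearMap.sum_apply, LinearMap.smul_apply, map_sum, map_smul]
  rw [← h, Finset.sum_comm]
  refine Finset.sum_congr rfl fun i _ => ?_
  simp only [Finset.smul_sum, smul_smul, pow_add, mul_comm]

theorem b'_b' (n : ℕ) (x : V E (n + 2)) : b' E n (b' E (n + 1) x) = 0 := by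
  have h := alt_sum_zero (k := k) (n + 1) (fun i j => face E n i (face E (n + 1) j x))
    (fun i j hij hj => face_face E hij (by omega) x)
  simp only [b', LinearMap.sum_apply, LinearMap.smul_apply, map_sum, map_smul]
  rw [← h, Finset.sum_comm]
  refine Finset.sum_congr rfl fun i _ => ?_
  simp only [Finset.smul_sum, smul_smul, pow_add, mul_comm]

theorem e_tau_pow (n i : ℕ) (hi : i ≤ n + 1) (j : ℕ) (x : V E (n + 1)) :
    (j ≤ i → (-1 : k) ^ i • face E n i ((tau E (n + 1) ^ j) x)
      = (tau E n ^ j) ((-1 : k) ^ (i - j) • face E n (i - j) x)) ∧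
    (i < j → j ≤ n + 2 → (-1 : k) ^ i • face E n i ((tau E (n + 1) ^ j) x)
      = (tau E n ^ (j - 1)) ((-1 : k) ^ (n + 2 + i - j) • face E n (n + 2 + i - j) x)) := by
  have step : ∀ i, i ≤ n → ∀ y, (-1 : k) ^ (i + 1) • face E n (i + 1) (tau E (n + 1) y)
      = tau E n ((-1 : k) ^ i • face E n i y) := by
    intro i hi y
    rw [face_tau_succ E hi, map_smul, pow_succ]; simp
  have low : ∀ j i, j ≤ i → i ≤ n + 1 → ∀ y, (-1 : k) ^ i • face E n i ((tau E (n + 1) ^ j) y)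
      = (tau E n ^ j) ((-1 : k) ^ (i - j) • face E n (i - j) y) := by
    intro j
    induction j with
    | zero => intro i _ _ y; rfl
    | succ j ih =>
      intro i hij hi y
      obtain ⟨i, rfl⟩ : ∃ l, i = l + 1 := ⟨i - 1, by omega⟩
      rw [pow_succ' (tau E (n + 1)), Module.End.mul_apply, step i (by omega),
        ih i (by omega) (by omega), pow_succ' (tau E n), Module.End.mul_apply,
        Nat.add_sub_add_right]
  refine ⟨fun hij => low j i hij hi x, fun hij hj => ?_⟩
  obtain ⟨l, rfl⟩ : ∃ l, j = i + (l + 1) := ⟨j - i - 1, by omega⟩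
  rw [pow_add, Module.End.mul_apply, low i i le_rfl hi, Nat.sub_self, pow_zero, one_smul, pow_succ' (tau E (n + 1)),
    Module.End.mul_apply, face_tau_zero, low l (n + 1) (by omega) le_rfl]
  have e1 : n + 2 + i - (i + (l + 1)) = n + 1 - l := by omega
  have e2 : i + (l + 1) - 1 = i + l := by omega
  rw [e1, e2, pow_add, Module.End.mul_apply]

/-- `b' ∘ (id + τ + ⋯ + τ ^ (n + 1)) = (id + τ + ⋯ + τ ^ n) ∘ b`. -/
theorem b'_norm (n : ℕ) (x : V E (n + 1)) :
    b' E n (normTau E (n + 1) x) = normTau E n (b E n x) := by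
  simp only [b', b, normTau, LinearMap.sum_apply, LinearMap.smul_apply, map_sum]
  rw [Finset.sum_comm, ← Finset.sum_product', ← Finset.sum_product']
  refine Finset.sum_nbij'
    (fun t => if t.2 ≤ t.1 then (t.1 - t.2, t.2) else (n + 2 + t.1 - t.2, t.2 - 1))
    (fun t => if t.1 + t.2 ≤ n then (t.1 + t.2, t.2) else (t.1 + t.2 - (n + 1), t.2 + 1))
    ?_ ?_ ?_ ?_ ?_
  all_goals
    rintro ⟨i, j⟩ ht
    simp only [Finset.mem_product, Finset.mem_range] at ht
  · dsimp only
    split_ifs <;> simp only [Finset.mem_product, Finset.mem_range] <;> omega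
  · dsimp only
    split_ifs <;> simp only [Finset.mem_product, Finset.mem_range] <;> omega
  · dsimp only
    split_ifs <;> refine Prod.ext ?_ ?_ <;> dsimp only at * <;> omega
  · dsimp only
    split_ifs <;> refine Prod.ext ?_ ?_ <;> dsimp only at * <;> omega
  · dsimp only
    split_ifs with hij
    · exact (e_tau_pow E n i (by omega) j x).1 hij
    · exact (e_tau_pow E n i (by omega) j x).2 (by omega) (by omega)

/-- `b ∘ (id - τ) = (id - τ) ∘ b'`. -/
theorem b_one_sub_tau (n : ℕ) (x : V E (n + 1)) :
    b E n (x - tau E (n + 1) x) = b' E n x - tau E n (b' E n x) := by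
  have h : b E n (tau E (n + 1) x)
      = tau E n (b' E n x) + (-1 : k) ^ (n + 1) • face E n (n + 1) x := by
    simp only [b, b', LinearMap.sum_apply, LinearMap.smul_apply]
    rw [Finset.sum_range_succ', map_sum, pow_zero, one_smul, face_tau_zero]
    congr 1
    refine Finset.sum_congr rfl fun i hi => ?_
    rw [Finset.mem_range] at hi
    rw [face_tau_succ E (by omega), map_smul, pow_succ]; simp
  have h' : b E n x = b' E n x + (-1 : k) ^ (n + 1) • face E n (n + 1) x := by
    simp only [b, b', LinearMap.sum_apply, LinearMap.smul_apply]
    rw [Finset.sum_range_succ]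
  rw [map_sub, h, h']; abel

theorem sigma_b (n : ℕ) (x : V E (n + 1)) : sigma E n (b E n x) = b E n (sigma E (n + 1) x) := by
  simp only [b, LinearMap.sum_apply, LinearMap.smul_apply, map_sum, map_smul, sigma_face]

theorem sigma_b' (n : ℕ) (x : V E (n + 1)) :
    sigma E n (b' E n x) = b' E n (sigma E (n + 1) x) := by
  simp only [b', LinearMap.sum_apply, LinearMap.smul_apply, map_sum, map_smul, sigma_face]

theorem normSigma_comm {n m : ℕ} (f : V E n →ₗ[k] V E m)
    (h : ∀ x, sigma E m (f x) = f (sigma E n x)) (x : V E n) :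
    normSigma E m (f x) = f (normSigma E n x) := by
  have hj : ∀ j x, (sigma E m ^ j) (f x) = f ((sigma E n ^ j) x) := by
    intro j
    induction j with
    | zero => intro x; rfl
    | succ j ih => intro x; rw [pow_succ, pow_succ, Module.End.mul_apply, h, ih]; rfl
  simp only [normSigma, LinearMap.sum_apply, map_sum, hj]

theorem tau_normTau (n : ℕ) (x : V E n) : tau E n (normTau E n x) = normTau E n (tau E n x) := by
  have h : tau E n * normTau E n = normTau E n * tau E n := by
    rw [normTau, Finset.mul_sum, Finset.sum_mul]
    exact Finset.sum_congr rfl fun j _ => (pow_succ' _ _).symm.trans (pow_succ _ _)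
  exact LinearMap.congr_fun h x

theorem sub_normTau (n : ℕ) (x : V E n) :
    normTau E n x - tau E n (normTau E n x) = x - sigma E n x := by
  have h := mul_neg_geom_sum (tau E n) (n + 1)
  rw [tau_pow] at h
  exact LinearMap.congr_fun h x

theorem sub_normSigma (n : ℕ) (x : V E n) :
    normSigma E n x - sigma E n (normSigma E n x) = 0 := by
  have h := mul_neg_geom_sum (sigma E n) p
  rw [sigma_pow, sub_self] at h
  exact LinearMap.congr_fun h x

theorem sigma_tau (n : ℕ) (x : V E n) : sigma E n (tau E n x) = tau E n (sigma E n x) := by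
  rw [← tau_pow]
  exact LinearMap.congr_fun ((pow_succ (tau E n) (n + 1)).symm.trans (pow_succ' _ _)) x

theorem sigma_normTau (n : ℕ) (x : V E n) :
    sigma E n (normTau E n x) = normTau E n (sigma E n x) := by
  have h : sigma E n * normTau E n = normTau E n * sigma E n := by
    rw [normTau, Finset.mul_sum, Finset.sum_mul]
    refine Finset.sum_congr rfl fun j _ => ?_
    rw [← tau_pow, ← pow_add, ← pow_add, add_comm]
  exact LinearMap.congr_fun h x

theorem normFull_eq (n : ℕ) (x : V E n) : normFull E n x = normSigma E n (normTau E n x) := by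
  have h : ∀ q, ∑ j ∈ Finset.range (q * (n + 1)), tau E n ^ j
      = (∑ j ∈ Finset.range q, sigma E n ^ j) * normTau E n := by
    intro q
    induction q with
    | zero => simp
    | succ q ih =>
      rw [Nat.succ_mul, Finset.sum_range_add, ih, Finset.sum_range_succ _ q, add_mul, normTau,
        Finset.mul_sum (a := sigma E n ^ q)]
      congr 1
      refine Finset.sum_congr rfl fun j _ => ?_
      rw [← tau_pow, ← pow_mul, ← pow_add, mul_comm q]
  exact LinearMap.congr_fun (h p) x

/-- The differential along the columns of the bicomplex computing cyclic homology: `b` in columns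
with an even number, `b'` in columns with an odd number. -/
def bar (r n : ℕ) : V E (n + 1) →ₗ[k] V E n := if Even r then b E n else b' E n

/-- `id - τ` (for `r` even) or `id + τ + ⋯ + τ ^ n` (for `r` odd). -/
def dTau (r n : ℕ) : Module.End k (V E n) := if Even r then 1 - tau E n else normTau E n

/-- `id - τ` (for `a` even) or `id + τ + ⋯ + τ ^ (p (n + 1) - 1)` (for `a` odd). -/
def dFull (a n : ℕ) : Module.End k (V E n) := if Even a then 1 - tau E n else normFull E n

/-- `id - σ` (for `c` even) or `id + σ + ⋯ + σ ^ (p - 1)` (for `c` odd). -/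
def dSigma (c n : ℕ) : Module.End k (V E n) := if Even c then 1 - sigma E n else normSigma E n

end Operators

section Graded

variable {k : Type u} [Field k] {ι κ : Type} {deg : ι → ℤ} {deg' : κ → ℤ}
  {M : ι → Type v} [∀ i, AddCommGroup (M i)] [∀ i, Module k (M i)]
  {L : κ → Type v} [∀ i, AddCommGroup (L i)] [∀ i, Module k (L i)]

/-- Given modules `M i` whose index `i` has the degree `deg i`, the module of the families of
elements of the `M i` that are supported in degree `N`. If only finitely many indices have degree
`N`, this is the direct sum of the `M i` with `deg i = N`. -/
def piece (k : Type u) [Field k] {ι : Type} (deg : ι → ℤ) (M : ι → Type v)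
    [∀ i, AddCommGroup (M i)] [∀ i, Module k (M i)] (N : ℤ) : Submodule k (∀ i, M i) where
  carrier := {x | ∀ i, deg i ≠ N → x i = 0}
  add_mem' hx hy i hi := by simp [hx i hi, hy i hi]
  zero_mem' _ _ := rfl
  smul_mem' a x hx i hi := by simp [hx i hi]

/-- The map `T` is homogeneous of degree `s`. -/
def Homog (deg : ι → ℤ) (deg' : κ → ℤ) (s : ℤ) (T : (∀ i, M i) →ₗ[k] (∀ i, L i)) : Prop :=
  ∀ N N' : ℤ, N + s = N' → ∀ x ∈ piece k deg M N, T x ∈ piece k deg' L N'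

/-- The chain complex with terms `piece k deg M N` and with the differential given by a homogeneous
map `D` of degree `-1` on the product of all `M i`. -/
def gradedComplex (D : (∀ i, M i) →ₗ[k] (∀ i, M i)) (hD : Homog deg deg (-1) D)
    (hDD : ∀ x, D (D x) = 0) : ChainComplex (ModuleCat.{v} k) ℤ where
  X N := ModuleCat.of k (piece k deg M N)
  d i j := if h : j + 1 = i then ModuleCat.ofHom (D.restrict (hD i j (by omega))) else 0
  shape i j h := dif_neg h
  d_comp_d' i j l hij hjl := by
    change j + 1 = i at hij
    change l + 1 = j at hjl
    rw [dif_pos hij, dif_pos hjl]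
    exact ModuleCat.hom_ext (LinearMap.ext fun x => Subtype.ext (hDD x.1))

variable {D : (∀ i, M i) →ₗ[k] (∀ i, M i)} {hD : Homog deg deg (-1) D} {hDD : ∀ x, D (D x) = 0}
  {D' : (∀ i, L i) →ₗ[k] (∀ i, L i)} {hD' : Homog deg' deg' (-1) D'}
  {hDD' : ∀ x, D' (D' x) = 0}

theorem gradedComplex_d {i j : ℤ} (h : j + 1 = i) :
    (gradedComplex D hD hDD).d i j = ModuleCat.ofHom (D.restrict (hD i j (by omega))) :=
  dif_pos h

/-- The chain map given by a map of degree `0` that commutes with the differentials. -/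
def gradedMap (T : (∀ i, M i) →ₗ[k] (∀ i, L i)) (hT : Homog deg deg' 0 T)
    (hTD : ∀ x, T (D x) = D' (T x)) :
    gradedComplex D hD hDD ⟶ gradedComplex D' hD' hDD' where
  f N := ModuleCat.ofHom (T.restrict (hT N N (add_zero N)))
  comm' i j hij := by
    rw [gradedComplex_d hij, gradedComplex_d hij]
    exact ModuleCat.hom_ext (LinearMap.ext fun x => Subtype.ext (hTD x.1).symm)

/-- The family of maps of degree `1` given by a map `H` of degree `1`. -/
def gradedHomotopyHom (H : (∀ i, M i) →ₗ[k] (∀ i, M i)) (hH : Homog deg deg 1 H) (i j : ℤ) :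
    (gradedComplex D hD hDD).X i ⟶ (gradedComplex D hD hDD).X j :=
  if h : i + 1 = j then ModuleCat.ofHom (H.restrict (hH i j h)) else 0

theorem gradedHomotopyHom_eq (H : (∀ i, M i) →ₗ[k] (∀ i, M i)) (hH : Homog deg deg 1 H) {i j : ℤ}
    (h : i + 1 = j) :
    gradedHomotopyHom (hD := hD) (hDD := hDD) H hH i j
      = ModuleCat.ofHom (H.restrict (hH i j h)) :=
  dif_pos h

/-- A map `H` of degree `1` with `T x - x = D (H x) + H (D x)` gives a chain homotopy from the
chain map given by `T` to the identity. -/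
def gradedHomotopy (T : (∀ i, M i) →ₗ[k] (∀ i, M i)) (hT : Homog deg deg 0 T)
    (hTD : ∀ x, T (D x) = D (T x))
    (H : (∀ i, M i) →ₗ[k] (∀ i, M i)) (hH : Homog deg deg 1 H)
    (hHD : ∀ x, T x - x = D (H x) + H (D x)) :
    Homotopy (gradedMap (hD := hD) (hDD := hDD) (hD' := hD) (hDD' := hDD) T hT hTD)
      (𝟙 (gradedComplex D hD hDD)) where
  hom := gradedHomotopyHom H hH
  zero i j h := dif_neg h
  comm i := by
    rw [dNext_eq _ (show (ComplexShape.down ℤ).Rel i (i - 1) from by simp),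
      prevD_eq _ (show (ComplexShape.down ℤ).Rel (i + 1) i from rfl),
      gradedComplex_d (by omega), gradedComplex_d rfl, gradedHomotopyHom_eq H hH rfl,
      gradedHomotopyHom_eq H hH (by omega)]
    refine ModuleCat.hom_ext (LinearMap.ext fun x => Subtype.ext ?_)
    have h := hHD x.1
    change T x.1 = H (D x.1) + D (H x.1) + x.1
    rw [add_comm (H (D x.1)), ← h]; abel

/-- The map on homology given by a map `S` of degree `-2` that commutes with the differential. -/
noncomputable def gradedShift (S : (∀ i, M i) →ₗ[k] (∀ i, M i)) (hS : Homog deg deg (-2) S)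
    (hSD : ∀ x, S (D x) = D (S x)) (N : ℤ) :
    (gradedComplex D hD hDD).homology N ⟶ (gradedComplex D hD hDD).homology (N - 2) :=
  ((gradedComplex D hD hDD).homologyIsoSc' (N + 1) N (N - 1) (by simp) (by simp)).hom ≫
    ShortComplex.homologyMap
      { τ₁ := ModuleCat.ofHom (S.restrict (hS (N + 1) (N - 1) (by ring)))
        τ₂ := ModuleCat.ofHom (S.restrict (hS N (N - 2) (by ring)))
        τ₃ := ModuleCat.ofHom (S.restrict (hS (N - 1) (N - 3) (by ring)))
        comm₁₂ := by
          change _ ≫ (gradedComplex D hD hDD).d (N - 1) (N - 2)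
            = (gradedComplex D hD hDD).d (N + 1) N ≫ _
          rw [gradedComplex_d (by ring), gradedComplex_d (by ring)]
          exact ModuleCat.hom_ext (LinearMap.ext fun x => Subtype.ext (hSD x.1).symm)
        comm₂₃ := by
          change _ ≫ (gradedComplex D hD hDD).d (N - 2) (N - 3)
            = (gradedComplex D hD hDD).d N (N - 1) ≫ _
          rw [gradedComplex_d (by ring), gradedComplex_d (by ring)]
          exact ModuleCat.hom_ext (LinearMap.ext fun x => Subtype.ext (hSD x.1).symm) } ≫
    ((gradedComplex D hD hDD).homologyIsoSc' (N - 1) (N - 2) (N - 3)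
      (by simp; ring) (by simp; ring)).inv

end Graded

section Relations

variable {k : Type u} [Field k] {p : ℕ} (E : Lam p ⥤ ModuleCat.{v} k)

theorem bar_add_two (r n : ℕ) : bar E (r + 2) n = bar E r n := by
  simp [bar, Nat.even_add]

theorem dTau_add_two (r n : ℕ) : dTau E (r + 2) n = dTau E r n := by
  simp [dTau, Nat.even_add]

theorem bar_bar (r n : ℕ) (x : V E (n + 2)) : bar E r n (bar E r (n + 1) x) = 0 := by
  unfold bar; split_ifs
  · exact b_b E n x
  · exact b'_b' E n x

theorem bar_dTau (r n : ℕ) (x : V E (n + 1)) :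
    bar E r n (dTau E r (n + 1) x) = dTau E r n (bar E (r + 1) n x) := by
  unfold bar dTau
  by_cases h : Even r
  · have h' : ¬ Even (r + 1) := by simpa [Nat.even_add_one] using h
    rw [if_pos h, if_pos h, if_pos h, if_neg h']
    exact b_one_sub_tau E n x
  · have h' : Even (r + 1) := by simpa [Nat.even_add_one] using h
    rw [if_neg h, if_neg h, if_neg h, if_pos h']
    exact b'_norm E n x

theorem dTau_dTau (r n : ℕ) (x : V E n) : dTau E r n (dTau E (r + 1) n x) = x - sigma E n x := by
  unfold dTau
  by_cases h : Even r
  · have h' : ¬ Even (r + 1) := by simpa [Nat.even_add_one] using h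
    rw [if_pos h, if_neg h']
    exact sub_normTau E n x
  · have h' : Even (r + 1) := by simpa [Nat.even_add_one] using h
    rw [if_neg h, if_pos h']
    change normTau E n (x - tau E n x) = _
    rw [map_sub, ← tau_normTau, sub_normTau]

theorem sigma_bar (r n : ℕ) (x : V E (n + 1)) :
    sigma E n (bar E r n x) = bar E r n (sigma E (n + 1) x) := by
  unfold bar; split_ifs
  · exact sigma_b E n x
  · exact sigma_b' E n x

theorem sigma_dTau (r n : ℕ) (x : V E n) :
    sigma E n (dTau E r n x) = dTau E r n (sigma E n x) := by
  unfold dTau; split_ifs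
  · change sigma E n (x - tau E n x) = sigma E n x - tau E n (sigma E n x)
    rw [map_sub, sigma_tau]
  · exact sigma_normTau E n x

theorem normSigma_bar (r n : ℕ) (x : V E (n + 1)) :
    normSigma E n (bar E r n x) = bar E r n (normSigma E (n + 1) x) :=
  normSigma_comm E _ (sigma_bar E r n) x

theorem normSigma_dTau (r n : ℕ) (x : V E n) :
    normSigma E n (dTau E r n x) = dTau E r n (normSigma E n x) :=
  normSigma_comm E _ (sigma_dTau E r n) x

theorem normSigma_sigma (n : ℕ) (x : V E n) :
    normSigma E n (sigma E n x) = sigma E n (normSigma E n x) :=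
  normSigma_comm E _ (fun _ => rfl) x

theorem dFull_dFull (a n : ℕ) (x : V E n) : dFull E a n (dFull E (a + 1) n x) = 0 := by
  have h0 : ∀ x, normFull E n x - tau E n (normFull E n x) = 0 := by
    intro x
    rw [normFull_eq]
    have h := normSigma_comm E (tau E n) (sigma_tau E n) (normTau E n x)
    rw [← h, ← map_sub, sub_normTau, map_sub, normSigma_sigma, sub_normSigma]
  unfold dFull
  by_cases h : Even a
  · have h' : ¬ Even (a + 1) := by simpa [Nat.even_add_one] using h
    rw [if_pos h, if_neg h']
    exact h0 x
  · have h' : Even (a + 1) := by simpa [Nat.even_add_one] using h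
    rw [if_neg h, if_pos h']
    change normFull E n (x - tau E n x) = 0
    rw [normFull_eq, map_sub, ← tau_normTau, sub_normTau, map_sub, normSigma_sigma, sub_normSigma]

theorem bar_dFull (a n : ℕ) (x : V E (n + 1)) :
    bar E a n (dFull E a (n + 1) x) = dFull E a n (bar E (a + 1) n x) := by
  have h := bar_dTau E a n
  unfold dFull
  unfold dTau at h
  by_cases ha : Even a
  · simp only [if_pos ha] at h ⊢
    exact h x
  · simp only [if_neg ha] at h ⊢
    rw [normFull_eq, normFull_eq, ← h, ← normSigma_bar]

end Relations

section Complexes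

variable {k : Type u} [Field k] {p : ℕ} (E : Lam p ⥤ ModuleCat.{v} k)

/-- Degree of the entry in column `a` (counted from the right, from `0`) and row `n` (counted from
the top, from `0`) of the bicomplex computing cyclic homology. -/
def hcDeg (t : ℕ × ℕ) : ℤ := t.1 + t.2

/-- The product of all the entries of the bicomplex computing cyclic homology; the entry in column
`a` and row `n` is `E([n + 1])`. -/
abbrev HCAll : Type v := ∀ t : ℕ × ℕ, V E t.2

/-- The coordinate `(a, n)`. -/
def hcEv (a n : ℕ) : HCAll E →ₗ[k] V E n := LinearMap.proj (a, n)

/-- The total differential of the bicomplex computing cyclic homology. Its component with values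
in the entry `(a, n)` comes from the entry `(a + 1, n)` by the differential of the row and from
`(a, n + 1)` by `b` (for `a` even) or `-b'` (for `a` odd). -/
def hcD : HCAll E →ₗ[k] HCAll E :=
  LinearMap.pi fun t =>
    dFull E t.1 t.2 ∘ₗ hcEv E (t.1 + 1) t.2
      + (-1 : k) ^ t.1 • (bar E t.1 t.2 ∘ₗ hcEv E t.1 (t.2 + 1))

/-- Degree of the entry in column `c` and row `r` of the diagram for `E([n + 1])`. -/
def hsDeg (t : ℕ × ℕ × ℕ) : ℤ := t.1 + t.2.1 + t.2.2

/-- The product, over all `n`, of the entries of the Hochschild-Serre diagrams for `E([n + 1])`: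
columns `c` are counted from the right and rows `r` from the top, from `0`, and all the entries
for a given `n` are `E([n + 1])`. -/
abbrev HSAll : Type v := ∀ t : ℕ × ℕ × ℕ, V E t.2.2

/-- The coordinate `(c, r, n)`. -/
def hsEv (c r n : ℕ) : HSAll E →ₗ[k] V E n := LinearMap.proj (c, r, n)

/-- The correcting term of the differential: `-id` from the entry `(c, r + 2, n)` to
`(c + 1, r, n)`, for `c` even. It compensates for the vertical differentials, which square to
`id - σ`. -/
def hsCorr : ℕ → ℕ → ∀ n : ℕ, HSAll E →ₗ[k] V E n
  | 0, _, _ => 0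
  | c + 1, r, n => if Even c then -hsEv E c (r + 2) n else 0

/-- The total differential of the Hochschild-Serre version of the complex computing cyclic
homology: `id - σ` and `id + σ + ⋯ + σ ^ (p - 1)` decrease `c`; up to sign, `id - τ` and
`id + τ + ⋯ + τ ^ n` decrease `r`, and `b` (in rows with `r` even) and `b'` (in rows with `r` odd)
decrease `n`; and there is the correcting term. -/
def hsD : HSAll E →ₗ[k] HSAll E :=
  LinearMap.pi fun t =>
    dSigma E t.1 t.2.2 ∘ₗ hsEv E (t.1 + 1) t.2.1 t.2.2
      + (-1 : k) ^ t.1 • (dTau E t.2.1 t.2.2 ∘ₗ hsEv E t.1 (t.2.1 + 1) t.2.2)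
      + (-1 : k) ^ (t.1 + t.2.1) • (bar E t.2.1 t.2.2 ∘ₗ hsEv E t.1 t.2.1 (t.2.2 + 1))
      + hsCorr E t.1 t.2.1 t.2.2

/-- The shift by two rows: the entry `(c, r + 2, n)` goes identically to the entry `(c, r, n)`, and
the entries in the rows `r = 0, 1` go to `0`. -/
def hsShift : HSAll E →ₗ[k] HSAll E := LinearMap.pi fun t => hsEv E t.1 (t.2.1 + 2) t.2.2

/-- The comparison map from the standard complex to its Hochschild-Serre version. It sends `x` in
the entry `(a, n)` to the element with the components `(id + σ + ⋯ + σ ^ (p - 1)) ^ (r / 2) x` in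
the entries `(c, r, n)` with `c + r = a` and `c` even. -/
def toHS : HCAll E →ₗ[k] HSAll E :=
  LinearMap.pi fun t => if Even t.1 then
    (normSigma E t.2.2 ^ (t.2.1 / 2)) ∘ₗ hcEv E (t.1 + t.2.1) t.2.2 else 0

/-- The component in the entry `(a, n)` of a map in the opposite direction. -/
def ofHSComp : ℕ → ∀ n : ℕ, HSAll E →ₗ[k] V E n
  | 0, n => hsEv E 0 0 n
  | a + 1, n => if Even a then hsEv E a 1 n + normTau E n ∘ₗ hsEv E (a + 1) 0 n
      else hsEv E (a + 1) 0 n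

/-- A homotopy inverse of the comparison map. -/
def ofHS : HSAll E →ₗ[k] HCAll E := LinearMap.pi fun t => ofHSComp E t.1 t.2

/-- The homotopy between `toHS ∘ ofHS` and the identity. -/
def hsHtpy : HSAll E →ₗ[k] HSAll E :=
  LinearMap.pi fun t => if Even t.1 then
    ∑ j ∈ Finset.range (t.2.1 / 2), (normSigma E t.2.2 ^ j) ∘ₗ
      hsEv E (t.1 + 1 + 2 * j) (t.2.1 - 2 - 2 * j) t.2.2 else 0

theorem hcD_apply (x : HCAll E) (a n : ℕ) : hcD E x (a, n)
    = dFull E a n (x (a + 1, n)) + (-1 : k) ^ a • bar E a n (x (a, n + 1)) := rfl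

theorem hsD_even (x : HSAll E) {c : ℕ} (hc : Even c) (r n : ℕ) : hsD E x (c, r, n)
    = x (c + 1, r, n) - sigma E n (x (c + 1, r, n)) + dTau E r n (x (c, r + 1, n))
      + (-1 : k) ^ r • bar E r n (x (c, r, n + 1)) := by
  have h : hsCorr E c r n x = 0 := by
    cases c with
    | zero => rfl
    | succ c =>
      have h' : ¬ Even c := by simpa [Nat.even_add_one] using hc
      simp [hsCorr, h']
  change dSigma E c n (x (c + 1, r, n)) + (-1 : k) ^ c • dTau E r n (x (c, r + 1, n))
    + (-1 : k) ^ (c + r) • bar E r n (x (c, r, n + 1)) + hsCorr E c r n x = _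
  rw [h, pow_add, hc.neg_one_pow, one_smul, one_mul, add_zero, dSigma, if_pos hc]
  rfl

theorem hsD_odd (x : HSAll E) {c : ℕ} (hc : Even c) (r n : ℕ) : hsD E x (c + 1, r, n)
    = normSigma E n (x (c + 2, r, n)) - dTau E r n (x (c + 1, r + 1, n))
      - (-1 : k) ^ r • bar E r n (x (c + 1, r, n + 1)) - x (c, r + 2, n) := by
  have h : hsCorr E (c + 1) r n x = -x (c, r + 2, n) := by
    simp [hsCorr, hc]; rfl
  have h' : ¬ Even (c + 1) := by simpa [Nat.even_add_one] using hc
  change dSigma E (c + 1) n (x (c + 2, r, n))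
    + (-1 : k) ^ (c + 1) • dTau E r n (x (c + 1, r + 1, n))
    + (-1 : k) ^ (c + 1 + r) • bar E r n (x (c + 1, r, n + 1)) + hsCorr E (c + 1) r n x = _
  rw [h, pow_add _ (c + 1) r, Odd.neg_one_pow (hc.add_one), dSigma, if_neg h']
  module

theorem hcD_hcD (x : HCAll E) : hcD E (hcD E x) = 0 := by
  funext ⟨a, n⟩
  simp only [hcD_apply, map_add, map_smul, dFull_dFull, bar_bar, bar_dFull, pow_succ, Pi.zero_apply]
  module

theorem hsD_hsD (x : HSAll E) : hsD E (hsD E x) = 0 := by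
  funext ⟨c, r, n⟩
  rw [Pi.zero_apply]
  rcases Nat.even_or_odd c with hc | hc
  · rw [hsD_even E _ hc]
    simp only [hsD_even E _ hc, hsD_odd E _ hc, map_add, map_sub, map_smul, bar_bar, bar_dTau,
      dTau_dTau, sigma_bar, sigma_dTau, pow_succ]
    have h := sub_normSigma E n (x (c + 2, r, n))
    rw [sub_eq_zero] at h
    rw [← h]
    module
  · obtain ⟨c, rfl⟩ : ∃ l, c = l + 1 := ⟨c - 1, by have := hc.pos; omega⟩
    have hc' : Even c := by simpa [Nat.odd_add_one] using hc
    have hc2 : Even (c + 2) := by simpa [Nat.even_add] using hc'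
    rw [hsD_odd E _ hc']
    simp only [hsD_even E _ hc', hsD_even E _ hc2, hsD_odd E _ hc', map_add, map_sub, map_smul,
      bar_bar, bar_dTau, dTau_dTau, normSigma_bar, normSigma_dTau, pow_succ, normSigma_sigma,
      bar_add_two, dTau_add_two]
    have h := sub_normSigma E n (x (c + 2 + 1, r, n))
    rw [sub_eq_zero] at h
    rw [← h]
    module

theorem hsShift_hsD (x : HSAll E) : hsShift E (hsD E x) = hsD E (hsShift E x) := by
  funext ⟨c, r, n⟩
  change hsD E x (c, r + 2, n) = _
  rcases Nat.even_or_odd c with hc | hc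
  · rw [hsD_even E _ hc, hsD_even E _ hc, bar_add_two, dTau_add_two, pow_add, neg_one_sq, mul_one]
    rfl
  · obtain ⟨c, rfl⟩ : ∃ l, c = l + 1 := ⟨c - 1, by have := hc.pos; omega⟩
    have hc' : Even c := by simpa [Nat.odd_add_one] using hc
    rw [hsD_odd E _ hc', hsD_odd E _ hc', bar_add_two, dTau_add_two, pow_add, neg_one_sq, mul_one]
    rfl

theorem toHS_even (x : HCAll E) {c : ℕ} (hc : Even c) (r n : ℕ) :
    toHS E x (c, r, n) = (normSigma E n ^ (r / 2)) (x (c + r, n)) := by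
  change (if Even c then (normSigma E n ^ (r / 2)) ∘ₗ hcEv E (c + r) n else 0) x = _
  rw [if_pos hc]; rfl

theorem toHS_odd (x : HCAll E) {c : ℕ} (hc : Even c) (r n : ℕ) :
    toHS E x (c + 1, r, n) = 0 := by
  have h' : ¬ Even (c + 1) := by simpa [Nat.even_add_one] using hc
  change (if Even (c + 1) then (normSigma E n ^ (r / 2)) ∘ₗ hcEv E (c + 1 + r) n else 0) x = _
  rw [if_neg h']; rfl

theorem normSigma_pow_comm {n m : ℕ} (f : V E n →ₗ[k] V E m)
    (h : ∀ x, normSigma E m (f x) = f (normSigma E n x)) (j : ℕ) (x : V E n) :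
    (normSigma E m ^ j) (f x) = f ((normSigma E n ^ j) x) := by
  induction j generalizing x with
  | zero => rfl
  | succ j ih => rw [pow_succ, pow_succ, Module.End.mul_apply, h, ih]; rfl

theorem bar_add_even {c : ℕ} (hc : Even c) (r n : ℕ) : bar E (c + r) n = bar E r n := by
  simp [bar, Nat.even_add, hc]

theorem toHS_hcD (x : HCAll E) : toHS E (hcD E x) = hsD E (toHS E x) := by
  funext ⟨c, r, n⟩
  rcases Nat.even_or_odd c with hc | hc
  · rw [toHS_even E _ hc, hsD_even E _ hc, toHS_odd E _ hc, toHS_even E _ hc, toHS_even E _ hc,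
      hcD_apply, map_add, map_smul, bar_add_even E hc, pow_add, hc.neg_one_pow, one_mul, map_zero,
      sub_zero, zero_add, normSigma_pow_comm E _ (normSigma_bar E r n)]
    congr 1
    · change (normSigma E n ^ (r / 2)) (dFull E (c + r) n (x (c + (r + 1), n))) = _
      unfold dFull dTau
      have he : Even (c + r) ↔ Even r := by simp [Nat.even_add, hc]
      by_cases hr : Even r
      · have e : (r + 1) / 2 = r / 2 := by obtain ⟨l, rfl⟩ := hr; omega
        rw [if_pos (he.2 hr), if_pos hr, e]
        exact normSigma_pow_comm E (1 - tau E n)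
          (normSigma_comm E _ fun x => by
            change sigma E n (x - tau E n x) = sigma E n x - tau E n (sigma E n x)
            rw [map_sub, sigma_tau]) _ _
      · have e : (r + 1) / 2 = r / 2 + 1 := by
          obtain ⟨l, rfl⟩ := Nat.not_even_iff_odd.1 hr; omega
        rw [if_neg (fun h => hr (he.1 h)), if_neg hr, e, normFull_eq, pow_succ,
          Module.End.mul_apply, normSigma_comm E (normTau E n) (sigma_normTau E n)]
        exact normSigma_pow_comm E _ (normSigma_comm E _ (sigma_normTau E n)) _ _
  · obtain ⟨c, rfl⟩ : ∃ l, c = l + 1 := ⟨c - 1, by have := hc.pos; omega⟩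
    have hc' : Even c := by simpa [Nat.odd_add_one] using hc
    have hc2 : Even (c + 2) := by simpa [Nat.even_add] using hc'
    rw [toHS_odd E _ hc', hsD_odd E _ hc', toHS_odd E _ hc', toHS_odd E _ hc',
      toHS_even E _ hc', toHS_even E _ hc2]
    have e : (r + 2) / 2 = r / 2 + 1 := by omega
    have e2 : c + 2 + r = c + (r + 2) := by ring
    rw [e, pow_succ', Module.End.mul_apply, e2]
    simp

theorem ofHS_zero (y : HSAll E) (n : ℕ) : ofHS E y (0, n) = y (0, 0, n) := rfl

theorem ofHS_odd (y : HSAll E) {a : ℕ} (ha : Even a) (n : ℕ) :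
    ofHS E y (a + 1, n) = y (a, 1, n) + normTau E n (y (a + 1, 0, n)) := by
  change (if Even a then hsEv E a 1 n + normTau E n ∘ₗ hsEv E (a + 1) 0 n
    else hsEv E (a + 1) 0 n) y = _
  rw [if_pos ha]; rfl

theorem ofHS_even (y : HSAll E) {a : ℕ} (ha : Even a) (n : ℕ) :
    ofHS E y (a, n) = y (a, 0, n) := by
  cases a with
  | zero => rfl
  | succ a =>
    have h' : ¬ Even a := by simpa [Nat.even_add_one] using ha
    change (if Even a then hsEv E a 1 n + normTau E n ∘ₗ hsEv E (a + 1) 0 n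
      else hsEv E (a + 1) 0 n) y = _
    rw [if_neg h']; rfl

theorem ofHS_hsD (y : HSAll E) : ofHS E (hsD E y) = hcD E (ofHS E y) := by
  funext ⟨a, n⟩
  rcases Nat.even_or_odd a with ha | ha
  · rw [ofHS_even E _ ha, hcD_apply, hsD_even E _ ha, ofHS_odd E _ ha, ofHS_even E _ ha,
      dFull, if_pos ha, ha.neg_one_pow, dTau, bar, bar, if_pos ha, if_pos Even.zero,
      if_pos Even.zero, pow_zero, ← sub_normTau]
    congr 1
    change _ + (y (a, 1, n) - tau E n (y (a, 1, n))) = (y (a, 1, n) + _) - tau E n (y (a, 1, n) + _)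
    rw [map_add]; abel
  · obtain ⟨a, rfl⟩ : ∃ l, a = l + 1 := ⟨a - 1, by have := ha.pos; omega⟩
    have ha' : Even a := by simpa [Nat.odd_add_one] using ha
    have ha2 : Even (a + 2) := by simpa [Nat.even_add] using ha'
    have h1 : ¬ Even (a + 1) := by simpa [Nat.even_add_one] using ha'
    have hb := b'_norm E n (y (a + 1, 0, n + 1))
    rw [ofHS_odd E _ ha', hcD_apply, ofHS_even E _ ha2, ofHS_odd E _ ha', hsD_even E _ ha',
      hsD_odd E _ ha', dFull, if_neg h1, normFull_eq, Odd.neg_one_pow ha, bar, bar, bar,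
      if_neg h1, if_neg (by decide : ¬ Even 1), if_pos Even.zero, dTau, dTau,
      if_neg (by decide : ¬ Even 1), if_pos Even.zero]
    change _ + normTau E n (_ - (y (a + 1, 1, n) - tau E n (y (a + 1, 1, n))) - _ - _) = _
    simp only [map_sub, map_add, map_smul, hb, ← tau_normTau, sub_normTau,
      normSigma_comm E _ (sigma_normTau E n), pow_zero, pow_one]
    module

theorem ofHS_toHS (x : HCAll E) : ofHS E (toHS E x) = x := by
  funext ⟨a, n⟩
  rcases Nat.even_or_odd a with ha | ha
  · rw [ofHS_even E _ ha, toHS_even E _ ha]; rfl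
  · obtain ⟨a, rfl⟩ : ∃ l, a = l + 1 := ⟨a - 1, by have := ha.pos; omega⟩
    have ha' : Even a := by simpa [Nat.odd_add_one] using ha
    rw [ofHS_odd E _ ha', toHS_even E _ ha', toHS_odd E _ ha', map_zero, add_zero]; rfl

theorem hsHtpy_odd (y : HSAll E) {c : ℕ} (hc : Even c) (r n : ℕ) :
    hsHtpy E y (c + 1, r, n) = 0 := by
  have h' : ¬ Even (c + 1) := by simpa [Nat.even_add_one] using hc
  simp [hsHtpy, h']

theorem hsHtpy_zero (y : HSAll E) (c n : ℕ) : hsHtpy E y (c, 0, n) = 0 := by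
  simp [hsHtpy]

theorem hsHtpy_one (y : HSAll E) (c n : ℕ) : hsHtpy E y (c, 1, n) = 0 := by
  simp [hsHtpy]

theorem hsHtpy_even (y : HSAll E) {c : ℕ} (hc : Even c) (r n : ℕ) :
    hsHtpy E y (c, r + 2, n) = y (c + 1, r, n) + normSigma E n (hsHtpy E y (c + 2, r, n)) := by
  have hc2 : Even (c + 2) := by simpa [Nat.even_add] using hc
  have h : ∀ {c : ℕ}, Even c → ∀ r, hsHtpy E y (c, r, n) = ∑ j ∈ Finset.range (r / 2),
      (normSigma E n ^ j) (y (c + 1 + 2 * j, r - 2 - 2 * j, n)) := by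
    intro c hc r
    change (if Even c then ∑ j ∈ Finset.range (r / 2), (normSigma E n ^ j) ∘ₗ
      hsEv E (c + 1 + 2 * j) (r - 2 - 2 * j) n else 0) y = _
    rw [if_pos hc, LinearMap.sum_apply]; rfl
  rw [h hc, h hc2, show (r + 2) / 2 = r / 2 + 1 by omega, Finset.sum_range_succ',
    map_sum (normSigma E n)]
  refine (add_comm _ _).trans (congrArg₂ (· + ·) rfl (Finset.sum_congr rfl fun j _ => ?_))
  rw [pow_succ', Module.End.mul_apply, show c + 1 + 2 * (j + 1) = c + 2 + 1 + 2 * j by ring,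
    show r + 2 - 2 - 2 * (j + 1) = r - 2 - 2 * j by omega]

theorem htpy_even (y : HSAll E) (n r : ℕ) : ∀ c, Even c →
    toHS E (ofHS E y) (c, r, n) - y (c, r, n)
      = hsD E (hsHtpy E y) (c, r, n) + hsHtpy E (hsD E y) (c, r, n) := by
  induction r using Nat.twoStepInduction with
  | zero =>
    intro c hc
    rw [toHS_even E _ hc, ofHS_even E _ (a := c + 0) hc, hsD_even E _ hc]
    simp [hsHtpy_zero, hsHtpy_one]
  | one =>
    intro c hc
    rw [toHS_even E _ hc, ofHS_odd E _ hc, hsD_even E _ hc, hsHtpy_one, hsHtpy_one,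
      hsHtpy_one, hsHtpy_even E _ hc, hsHtpy_zero, dTau, if_neg (by decide : ¬ Even 1)]
    simp
  | more r ih _ =>
    intro c hc
    have hc2 : Even (c + 2) := by simpa [Nat.even_add] using hc
    have ih' := congrArg (normSigma E n) (ih (c + 2) hc2)
    rw [toHS_even E _ hc2, hsD_even E _ hc2, hsHtpy_odd E _ hc2] at ih'
    rw [toHS_even E _ hc, hsD_even E _ hc, hsHtpy_even E _ hc, hsHtpy_odd E _ hc,
      hsHtpy_even E _ hc, hsHtpy_even E _ hc, hsD_odd E _ hc,
      show (r + 2) / 2 = r / 2 + 1 by omega, pow_succ', Module.End.mul_apply,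
      show c + (r + 2) = c + 2 + r by ring, bar_add_two, dTau_add_two]
    simp only [map_add, map_sub, map_smul, map_zero, sub_zero, zero_add, normSigma_bar,
      normSigma_dTau, pow_add] at ih' ⊢
    rw [sub_eq_iff_eq_add] at ih'
    rw [ih']
    simp only [neg_one_sq, mul_one]
    module

theorem htpy (y : HSAll E) : toHS E (ofHS E y) - y
    = hsD E (hsHtpy E y) + hsHtpy E (hsD E y) := by
  funext ⟨c, r, n⟩
  simp only [Pi.sub_apply, Pi.add_apply]
  rcases Nat.even_or_odd c with hc | hc
  · exact htpy_even E y n r c hc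
  · obtain ⟨c, rfl⟩ : ∃ l, c = l + 1 := ⟨c - 1, by have := hc.pos; omega⟩
    have hc' : Even c := by simpa [Nat.odd_add_one] using hc
    rw [toHS_odd E _ hc', hsD_odd E _ hc', hsHtpy_odd E _ hc', hsHtpy_odd E _ hc',
      hsHtpy_odd E _ hc', hsHtpy_even E _ hc']
    simp

theorem hcD_homog : Homog hcDeg hcDeg (-1) (hcD E) := by
  rintro N N' hN x hx ⟨a, n⟩ ht
  simp only [hcDeg] at ht
  rw [hcD_apply, hx (a + 1, n) (by simp only [hcDeg]; push_cast; omega),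
    hx (a, n + 1) (by simp only [hcDeg]; push_cast; omega)]
  simp

theorem hsD_homog : Homog hsDeg hsDeg (-1) (hsD E) := by
  rintro N N' hN x hx ⟨c, r, n⟩ ht
  simp only [hsDeg] at ht
  have h : ∀ c' r' n' : ℕ, ((c' + r' + n' : ℕ) : ℤ) = c + r + n + 1 → x (c', r', n') = 0 := by
    intro c' r' n' h
    exact hx _ (by simp only [hsDeg]; push_cast at h; omega)
  rcases Nat.even_or_odd c with hc | hc
  · rw [hsD_even E _ hc, h (c + 1) r n (by push_cast; ring), h c (r + 1) n (by push_cast; ring),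
      h c r (n + 1) (by push_cast; ring)]
    simp
  · obtain ⟨c, rfl⟩ : ∃ l, c = l + 1 := ⟨c - 1, by have := hc.pos; omega⟩
    have hc' : Even c := by simpa [Nat.odd_add_one] using hc
    rw [hsD_odd E _ hc', h (c + 2) r n (by push_cast; ring),
      h (c + 1) (r + 1) n (by push_cast; ring), h (c + 1) r (n + 1) (by push_cast; ring),
      h c (r + 2) n (by push_cast; ring)]
    simp

theorem hsShift_homog : Homog hsDeg hsDeg (-2) (hsShift E) := by
  rintro N N' hN x hx ⟨c, r, n⟩ ht
  simp only [hsDeg] at ht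
  exact hx (c, r + 2, n) (by simp only [hsDeg]; push_cast; omega)

theorem toHS_homog : Homog hcDeg hsDeg 0 (toHS E) := by
  rintro N N' hN x hx ⟨c, r, n⟩ ht
  simp only [hsDeg] at ht
  rcases Nat.even_or_odd c with hc | hc
  · rw [toHS_even E _ hc, hx (c + r, n) (by simp only [hcDeg]; push_cast; omega), map_zero]
  · obtain ⟨c, rfl⟩ : ∃ l, c = l + 1 := ⟨c - 1, by have := hc.pos; omega⟩
    exact toHS_odd E _ (by simpa [Nat.odd_add_one] using hc) _ _

theorem ofHS_homog : Homog hsDeg hcDeg 0 (ofHS E) := by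
  rintro N N' hN x hx ⟨a, n⟩ ht
  simp only [hcDeg] at ht
  rcases Nat.even_or_odd a with ha | ha
  · rw [ofHS_even E _ ha, hx (a, 0, n) (by simp only [hsDeg]; push_cast; omega)]
  · obtain ⟨a, rfl⟩ : ∃ l, a = l + 1 := ⟨a - 1, by have := ha.pos; omega⟩
    push_cast at ht
    rw [ofHS_odd E _ (by simpa [Nat.odd_add_one] using ha),
      hx (a, 1, n) (by simp only [hsDeg]; push_cast; omega),
      hx (a + 1, 0, n) (by simp only [hsDeg]; push_cast; omega), map_zero, add_zero]

theorem hsHtpy_homog : Homog hsDeg hsDeg 1 (hsHtpy E) := by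
  rintro N N' hN x hx ⟨c, r, n⟩ ht
  rcases Nat.even_or_odd c with hc | hc
  · induction r using Nat.twoStepInduction generalizing c with
    | zero => exact hsHtpy_zero E x c n
    | one => exact hsHtpy_one E x c n
    | more r ih _ =>
      simp only [hsDeg] at ht
      push_cast at ht
      rw [hsHtpy_even E x hc, hx (c + 1, r, n) (by simp only [hsDeg]; push_cast; omega),
        ih (c + 2) (by simp only [hsDeg]; push_cast; omega) (by simpa [Nat.even_add] using hc),
        map_zero, add_zero]
  · obtain ⟨c, rfl⟩ : ∃ l, c = l + 1 := ⟨c - 1, by have := hc.pos; omega⟩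
    exact hsHtpy_odd E _ (by simpa [Nat.odd_add_one] using hc) _ _

/-- The total complex of the bicomplex computing the cyclic homology of a `p`-cyclic object. -/
def hcComplex : ChainComplex (ModuleCat.{v} k) ℤ :=
  gradedComplex (hcD E) (hcD_homog E) (hcD_hcD E)

/-- The Hochschild-Serre version of the complex computing the cyclic homology of a `p`-cyclic
object: the rows of the bicomplex are replaced by the total complexes of the diagrams. -/
def hsComplex : ChainComplex (ModuleCat.{v} k) ℤ :=
  gradedComplex (hsD E) (hsD_homog E) (hsD_hsD E)

/-- The cyclic homology `HC_N(E)` of a `p`-cyclic object `E`. -/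
noncomputable def HC (N : ℤ) : ModuleCat.{v} k := (hcComplex E).homology N

/-- The comparison map is a chain homotopy equivalence. -/
noncomputable def hsEquiv : HomotopyEquiv (hcComplex E) (hsComplex E) where
  hom := gradedMap (toHS E) (toHS_homog E) (toHS_hcD E)
  inv := gradedMap (ofHS E) (ofHS_homog E) (ofHS_hsD E)
  homotopyHomInvId := Homotopy.ofEq (by
    ext N x
    exact Subtype.ext (ofHS_toHS E x.1))
  homotopyInvHomId := (Homotopy.ofEq (by rfl)).trans
    (gradedHomotopy (hD := hsD_homog E) (hDD := hsD_hsD E) (toHS E ∘ₗ ofHS E)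
      (fun N N' h x hx => toHS_homog E N N' h _ (ofHS_homog E N N (add_zero N) x hx))
      (fun x => by
        change toHS E (ofHS E (hsD E x)) = hsD E (toHS E (ofHS E x))
        rw [ofHS_hsD, toHS_hcD])
      (hsHtpy E) (hsHtpy_homog E) (htpy E))

/-- The Hochschild-Serre version of the complex computes cyclic homology. -/
noncomputable def hcIso (N : ℤ) : HC E N ≅ (hsComplex E).homology N :=
  (hsEquiv E).toHomologyIso N

/-- The vertical periodicity map `u' : HC_N(E) → HC_{N - 2}(E)`, induced by the shift by two rows
of the Hochschild-Serre version of the complex. -/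
noncomputable def uPrime (N : ℤ) : HC E N ⟶ HC E (N - 2) :=
  (hcIso E N).hom ≫
    gradedShift (hD := hsD_homog E) (hDD := hsD_hsD E) (hsShift E) (hsShift_homog E)
      (hsShift_hsD E) N ≫
    (hcIso E (N - 2)).inv

end Complexes

end PCyclic

/-! On the image of the comparison map `toHS`, the vertical shift can be read off the bicomplex. The
components of `toHS E x` in rows `r` and `r + 2` differ by one factor `id + σ + ⋯ + σ ^ (p - 1)`. So
dropping two rows corresponds to dropping two columns of the bicomplex and then applying this norm
of `σ`. In other words, `u'` is the ordinary periodicity map followed by the norm of `σ`.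

The norm of `σ` acts by zero on cyclic homology. The factorization `id - σ = (id - τ)(id + τ + ⋯ + τ
^ n)`, together with `b' ∘ normTau = normTau ∘ b`, makes `σ` chain homotopic to the identity, with
`normTau` from even to odd columns as the homotopy. Hence the norm is homotopic to `p`, which is
zero in `k`. Explicitly, the norm equals `(σ - id) ∘ partialNorms` (`sigma_partialNorms`), and the
homotopy is `normTau ∘ partialNorms` up to sign. `hcD_hcHtpy` is this computation, already composed
with the shift by two columns.

To obtain a homotopy on the whole Hochschild-Serre complex, and not only on the image of `toHS`, the
homotopy of the bicomplex is conjugated by `toHS` and `ofHS` and corrected by the known homotopy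
`hsHtpy` between `toHS ∘ ofHS` and the identity (`hsShift_eq`). A shift that is null-homotopic then
induces zero on homology (`gradedShift_eq_zero`). -/

namespace PCyclic

/-! ### Null-homotopic maps of degree -2 on homology -/

section Graded

variable {k : Type u} [Field k] {ι : Type} {deg : ι → ℤ}
  {M : ι → Type v} [∀ i, AddCommGroup (M i)] [∀ i, Module k (M i)]
  {D : (∀ i, M i) →ₗ[k] (∀ i, M i)} {hD : Homog deg deg (-1) D} {hDD : ∀ x, D (D x) = 0}

/-- A map of degree `-2` that is null-homotopic induces zero on homology. -/
theorem gradedShift_eq_zero (S : (∀ i, M i) →ₗ[k] (∀ i, M i)) (hS : Homog deg deg (-2) S)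
    (hSD : ∀ x, S (D x) = D (S x)) (G : (∀ i, M i) →ₗ[k] (∀ i, M i))
    (hG : Homog deg deg (-1) G) (hGD : ∀ x, S x = D (G x) + G (D x)) (N : ℤ) :
    gradedShift (hD := hD) (hDD := hDD) S hS hSD N = 0 := by
  have hd : ∀ i j (h : j + 1 = i), (gradedComplex D hD hDD).d i j
      = ModuleCat.ofHom (D.restrict (hD i j (by omega))) := fun i j h => gradedComplex_d h
  -- Fixing source and target here gives the two diagonal components the types of terms of the
  -- complex, so that they compose with its differentials below.
  let G₁ : (gradedComplex D hD hDD).X N ⟶ (gradedComplex D hD hDD).X (N - 1) :=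
    ModuleCat.ofHom (G.restrict (hG N (N - 1) (by ring)))
  let G₂ : (gradedComplex D hD hDD).X (N - 1) ⟶ (gradedComplex D hD hDD).X (N - 2) :=
    ModuleCat.ofHom (G.restrict (hG (N - 1) (N - 2) (by ring)))
  unfold gradedShift
  -- A homotopy of short complexes sees only three terms. At the left end the summand `D ∘ G` passes
  -- through degree `N`, and at the right end `G ∘ D` passes through degree `N - 2`; both places lie
  -- outside the target, respectively source, three-term complex at that end. These summands become
  -- the free components `h₀` and `h₃`, which are admissible because `D ∘ D = 0`.
  rw [ShortComplex.Homotopy.homologyMap_congr (φ₂ := 0)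
    { h₀ := ModuleCat.ofHom (G.restrict (hG (N + 1) N (by ring))) ≫
        ModuleCat.ofHom (D.restrict (hD N (N - 1) (by ring)))
      h₁ := G₁
      h₂ := G₂
      h₃ := ModuleCat.ofHom (D.restrict (hD (N - 1) (N - 2) (by ring))) ≫
        ModuleCat.ofHom (G.restrict (hG (N - 2) (N - 3) (by ring)))
      h₀_f := by
        change _ ≫ (gradedComplex D hD hDD).d (N - 1) (N - 2) = 0
        rw [hd _ _ (by ring)]
        exact ModuleCat.hom_ext (LinearMap.ext fun x => Subtype.ext (hDD (G x.1)))
      g_h₃ := by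
        change (gradedComplex D hD hDD).d N (N - 1) ≫ _ = 0
        rw [hd _ _ (by ring)]
        refine ModuleCat.hom_ext (LinearMap.ext fun x => Subtype.ext ?_)
        change G (D (D x.1)) = 0
        rw [hDD, map_zero]
      comm₁ := by
        change _ = (gradedComplex D hD hDD).d (N + 1) N ≫ _ + _ + 0
        rw [hd _ _ (by ring), add_zero]
        refine ModuleCat.hom_ext (LinearMap.ext fun x => Subtype.ext ?_)
        exact (hGD x.1).trans (add_comm _ _)
      comm₂ := by
        change _ = (gradedComplex D hD hDD).d N (N - 1) ≫ G₂
          + G₁ ≫ (gradedComplex D hD hDD).d (N - 1) (N - 2) + 0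
        rw [hd _ _ (by ring), hd _ _ (by ring), add_zero]
        refine ModuleCat.hom_ext (LinearMap.ext fun x => Subtype.ext ?_)
        exact (hGD x.1).trans (add_comm _ _)
      comm₃ := by
        change _ = _ + _ ≫ (gradedComplex D hD hDD).d (N - 2) (N - 3) + 0
        rw [hd _ _ (by ring), add_zero]
        refine ModuleCat.hom_ext (LinearMap.ext fun x => Subtype.ext ?_)
        exact (hGD x.1).trans (add_comm _ _) }]
  simp

end Graded

/-! ### The norm of `σ` as a multiple of `σ - id` in characteristic `p` -/

section Periodicity

variable {k : Type u} [Field k] {p : ℕ} (E : Lam p ⥤ ModuleCat.{v} k)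

/-- The sum over `j < p` of `id + σ + ⋯ + σ ^ (j - 1)`, the quotient of
`p - (id + σ + ⋯ + σ ^ (p - 1))` by `id - σ`. -/
def partialNorms (n : ℕ) : Module.End k (V E n) :=
  ∑ j ∈ Finset.range p, ∑ i ∈ Finset.range j, sigma E n ^ i

/-- `partialNorms` is a polynomial in `σ`, so it inherits every commutation of `σ`. It is needed for
`f = τ` and `f = b`. -/
theorem partialNorms_comm {n m : ℕ} (f : V E n →ₗ[k] V E m)
    (h : ∀ x, sigma E m (f x) = f (sigma E n x)) (x : V E n) :
    partialNorms E m (f x) = f (partialNorms E n x) := by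
  have hj : ∀ j x, (sigma E m ^ j) (f x) = f ((sigma E n ^ j) x) := by
    intro j
    induction j with
    | zero => intro x; rfl
    | succ j ih => intro x; rw [pow_succ, pow_succ, Module.End.mul_apply, h, ih]; rfl
  simp only [partialNorms, LinearMap.sum_apply, map_sum, hj]

/-- Each inner sum telescopes to `σ ^ j - id` after multiplication by `σ - id`. Summing over `j < p`
leaves the norm minus `p`, and `p` vanishes in `k`. This is where the characteristic enters. -/
theorem sigma_partialNorms [CharP k p] (n : ℕ) (x : V E n) :
    sigma E n (partialNorms E n x) - partialNorms E n x = normSigma E n x := by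
  have h : (sigma E n - 1) * partialNorms E n = normSigma E n := by
    have hp : (p : Module.End k (V E n)) = 0 := by
      ext y
      simp [← Nat.cast_smul_eq_nsmul k]
    rw [partialNorms, normSigma, Finset.mul_sum,
      Finset.sum_congr rfl fun j _ => mul_geom_sum (sigma E n) j, Finset.sum_sub_distrib,
      Finset.sum_const, Finset.card_range, nsmul_one, hp, sub_zero]
  rw [← h, sub_mul, one_mul]
  rfl

/-! ### The homotopy on the bicomplex -/

/-- The composition of the shift by two columns with a homotopy from `id + σ + ⋯ + σ ^ (p - 1)`
to `p` on the bicomplex computing cyclic homology. -/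
def hcHtpy : HCAll E →ₗ[k] HCAll E :=
  LinearMap.pi fun t => if Even t.1 then 0 else
    -(normTau E t.2 ∘ₗ partialNorms E t.2 ∘ₗ hcEv E (t.1 + 1) t.2)

theorem hcHtpy_even (x : HCAll E) {a : ℕ} (ha : Even a) (n : ℕ) : hcHtpy E x (a, n) = 0 := by
  simp [hcHtpy, ha]

theorem hcHtpy_odd (x : HCAll E) {a : ℕ} (ha : ¬ Even a) (n : ℕ) :
    hcHtpy E x (a, n) = -normTau E n (partialNorms E n (x (a + 1, n))) := by
  simp [hcHtpy, ha, hcEv]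

theorem hcHtpy_homog : Homog hcDeg hcDeg (-1) (hcHtpy E) := by
  rintro N N' hN x hx ⟨a, n⟩ ht
  simp only [hcDeg] at ht
  by_cases ha : Even a
  · exact hcHtpy_even E x ha n
  · rw [hcHtpy_odd E x ha, hx (a + 1, n) (by simp only [hcDeg]; push_cast; omega)]
    simp

/-- The homotopy is the row differential `normFull = normSigma ∘ normTau` from even to odd columns
with `normSigma` replaced by `-partialNorms`. Composed on either side with `id - τ`, it gives `-(id
- σ) ∘ partialNorms`, which is the norm of `σ`. In even columns nothing else survives. In odd
columns the contributions of `b` and `-b'` cancel. -/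
theorem hcD_hcHtpy [CharP k p] (x : HCAll E) (a n : ℕ) :
    hcD E (hcHtpy E x) (a, n) + hcHtpy E (hcD E x) (a, n) = normSigma E n (x (a + 2, n)) := by
  by_cases ha : Even a
  · have h1 : ¬ Even (a + 1) := by simpa [Nat.even_add_one] using ha
    rw [hcD_apply, hcHtpy_even E _ ha, hcHtpy_even E _ ha, hcHtpy_odd E _ h1, dFull, if_pos ha,
      map_zero, smul_zero, add_zero, add_zero, map_neg]
    -- Only `(id - τ) ∘ normTau = id - σ` is left; the minus sign in `hcHtpy` turns it into `σ -
    -- id`.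
    change -(normTau E n _ - tau E n (normTau E n _)) = _
    rw [sub_normTau, neg_sub, sigma_partialNorms]
  · have h1 : Even (a + 1) := by simpa [Nat.even_add_one] using ha
    -- The same factorization with `id - τ` applied first, which requires moving `τ` past
    -- `partialNorms` and `normTau`.
    have hK : normTau E n (partialNorms E n (x (a + 2, n) - tau E n (x (a + 2, n))))
        = -normSigma E n (x (a + 2, n)) := by
      rw [map_sub, partialNorms_comm E (tau E n) (sigma_tau E n), map_sub, ← tau_normTau,
        sub_normTau, ← sigma_partialNorms, neg_sub]
    -- The two vertical contributions: `b'` after the homotopy, in the odd column `a`, and `b`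
    -- before it, in the even column `a + 1`. They enter with opposite signs, since the vertical
    -- differential in odd columns is `-b'`.
    have hb : b' E n (normTau E (n + 1) (partialNorms E (n + 1) (x (a + 1, n + 1))))
        = normTau E n (partialNorms E n (b E n (x (a + 1, n + 1)))) := by
      rw [b'_norm, partialNorms_comm E (b E n) (sigma_b E n)]
    rw [hcD_apply, hcHtpy_even E _ h1, hcHtpy_odd E _ ha, hcHtpy_odd E _ ha, hcD_apply, map_zero,
      zero_add, dFull, if_pos h1, bar, bar, if_neg ha, if_pos h1, h1.neg_one_pow, one_smul,
      (Nat.not_even_iff_odd.1 ha).neg_one_pow, map_add, map_add, map_neg, hb]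
    change _ + -(normTau E n (partialNorms E n (x (a + 2, n) - tau E n (x (a + 2, n)))) + _) = _
    rw [hK]
    module

/-! ### Transport to the Hochschild-Serre version -/

/-- Two rows further down, the exponent `r / 2` in `toHS` has grown by one. The extra factor is the
norm of `σ`, applied to the entry of `x` two columns further, and `hcD_hcHtpy` writes exactly this
as a boundary expression. -/
theorem hsShift_toHS [CharP k p] (x : HCAll E) :
    hsShift E (toHS E x) = toHS E (hcD E (hcHtpy E x) + hcHtpy E (hcD E x)) := by
  funext ⟨c, r, n⟩
  change toHS E x (c, r + 2, n) = _
  rcases Nat.even_or_odd c with hc | hc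
  -- `pow_succ` splits off the innermost factor of the power, the one that acts directly on `x (c +
  -- r + 2, n)`.
  · rw [toHS_even E _ hc, toHS_even E _ hc, Pi.add_apply, hcD_hcHtpy,
      show (r + 2) / 2 = r / 2 + 1 by omega, pow_succ, Module.End.mul_apply]
    rfl
  · obtain ⟨c, rfl⟩ := hc.exists_bit1
    rw [toHS_odd E _ (even_two_mul c), toHS_odd E _ (even_two_mul c)]

/-- A homotopy from the shift by two rows to zero. -/
def hsShiftHtpy : HSAll E →ₗ[k] HSAll E :=
  toHS E ∘ₗ hcHtpy E ∘ₗ ofHS E - hsShift E ∘ₗ hsHtpy E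

theorem hsShiftHtpy_homog : Homog hsDeg hsDeg (-1) (hsShiftHtpy E) := fun N N' hN x hx =>
  Submodule.sub_mem _
    (toHS_homog E N' N' (add_zero _) _
      (hcHtpy_homog E N N' hN _ (ofHS_homog E N N (add_zero _) x hx)))
    -- The correction term first raises the degree by one, then lowers it by two.
    (hsShift_homog E (N + 1) N' (by omega) _ (hsHtpy_homog E N (N + 1) rfl x hx))

/-- Applying the shift `S` to `toHS ∘ ofHS - id = D H + H D` expresses `S` as `S ∘ toHS ∘ ofHS - (D
S H + S H D)`, because `S` commutes with `D`. The first term is null-homotopic by `hsShift_toHS`,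
since `toHS` and `ofHS` are chain maps; the second shows why `S ∘ H` is subtracted in `hsShiftHtpy`.
-/
theorem hsShift_eq [CharP k p] (x : HSAll E) :
    hsShift E x = hsD E (hsShiftHtpy E x) + hsShiftHtpy E (hsD E x) := by
  have h := congrArg (hsShift E) (htpy E x)
  rw [map_sub, hsShift_toHS, map_add, map_add, toHS_hcD, hsShift_hsD, sub_eq_iff_eq_add] at h
  simp only [hsShiftHtpy, LinearMap.sub_apply, LinearMap.comp_apply, map_sub, ofHS_hsD]
  rw [← sub_eq_iff_eq_add'] at h
  rw [← h]
  abel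

end Periodicity

end PCyclic

theorem mainTheorem8 {k : Type*} [Field k] (p : ℕ) (hp : 1 ≤ p) [CharP k p]
    (E : PCyclic.Lam p ⥤ ModuleCat k) (N : ℤ) : PCyclic.uPrime E N = 0 := by
  -- The zero map is typed through `hsComplex E`, so that it composes with the isomorphisms `hcIso`
  -- that conjugate the shift into `uPrime`.
  have h : PCyclic.gradedShift _ (PCyclic.hsShift_homog E) (PCyclic.hsShift_hsD E) N
      = (0 : (PCyclic.hsComplex E).homology N ⟶ (PCyclic.hsComplex E).homology (N - 2)) :=
    PCyclic.gradedShift_eq_zero _ _ _ (PCyclic.hsShiftHtpy E) (PCyclic.hsShiftHtpy_homog E)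
      (PCyclic.hsShift_eq E) N
  exact (congrArg (fun f => (PCyclic.hcIso E N).hom ≫ f ≫ (PCyclic.hcIso E (N - 2)).inv) h).trans
    (by rw [Limits.zero_comp, Limits.comp_zero])
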